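/- Let $d\in\mathbb N$. Fix functions $\phi_{(n)}\in C^\infty(\mathbb R^d;\mathbb R)$, $n\in\mathbb N$, with $\phi_{(n)}(\xi)=1$ for $|\xi|\le 2^{-n}$, $\phi_{(n)}(\xi)=0$ for $|\xi|>2^{n+1}$, and $\sup_n\|x^\beta\partial^\alpha\phi_{(n)}\|_{L^1}<\infty$ for all multi-indices $\alpha,\beta$. The dyadic partition of size $n$ consists of the Fourier multipliers $\Delta_0$ with symbol $\phi_{(n)}(\xi)$ and $\Delta_k$ with symbol $\phi_{(n)}(2^{-k}\xi)-\phi_{(n)}(2^{-(k-1)}\xi)$, $k\ge1$. For a given partition, $C^s_*$ is the space of (complex-valued) tempered distributions $u$ with $\|u\|_{C^s_*}=\sup_{q\ge0}2^{qs}\|\Delta_qu\|_{L^\infty}<\infty$; $H^s$ is the usual $L^2$-based Sobolev space. Let $\kappa:\mathbb R^d_1\to\mathbb R^d_2$ (two copies of $\mathbb R^d$) be a $C^1$ diffeomorphism with $\kappa'$ bounded and $|\det\kappa'(x)|\ge m_0>0$ for all $x$. Equip $\mathbb R^d_2$ with the partition of size $0$ and $\mathbb R^d_1$ with the partition of size $n_0$,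 and use these partitions for the norms of $C^s_*(\mathbb R^d_2)$ and $C^s_*(\mathbb R^d_1)$. Here $n_0\in\mathbb N$ and a width $\widetilde N\in\mathbb N$ are given as functions of $(m_0,\|\kappa'\|_{L^\infty})$ only; these functions are fixed once and for all and are otherwise arbitrary. For a tempered distribution $v$ on $\mathbb R^d_1$ put $[v]_p=\sum_{j\ge0,\ |j-p|\le\widetilde N}\Delta_jv$ (blocks of size $n_0$), and for $u$ on $\mathbb R^d_2$ put $u_p=\Delta_pu$ (blocks of size $0$). The global paracomposition is $$\kappa^*_gu=\sum_{p=0}^\infty[u_p\circ\kappa]_p .$$ Theorem. For every $s\in\mathbb R$ there is a function $\mathcal F$ with values in $[0,\infty)$, independent of $\kappa$, such that for every $\kappa$ and $m_0$ as above: (i) for every $u\in C^s_*(\mathbb R^d_2)$ the series defining $\kappa^*_gu$ converges in $\mathcal S'(\mathbb R^d_1)$, $\kappa^*_gu$ is uniquely determined, and $\|\kappa^*_gu\|_{C^s_*}\le\mathcal F(m_0,\|\kappa'\|_{L^\infty})\,\|u\|_{C^s_*}$; (ii) for every $u\in H^s(\mathbb R^d_2)$ the series defining $\kappa^*_gu$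 converges in $\mathcal S'(\mathbb R^d_1)$, $\kappa^*_gu$ is uniquely determined and belongs to $H^s(\mathbb R^d_1)$, and $\|\kappa^*_gu\|_{H^s}\le\mathcal F(m_0,\|\kappa'\|_{L^\infty})\,\|u\|_{H^s}$. -/

import Mathlib

open MeasureTheory TemperedDistribution
open scoped SchwartzMap ENNReal NNReal ContDiff

noncomputable section

namespace Paracomp

/-- The Euclidean space `ℝ^d`. -/
abbrev Eu (d : ℕ) : Type := EuclideanSpace ℝ (Fin d)

/-- A family `φ_(n)`, `n ∈ ℕ`, of smooth cut-off functions on `ℝ^d` with `φ_(n) = 1` on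
`|ξ| ≤ 2^(-n)`, `φ_(n) = 0` on `|ξ| > 2^(n+1)`, and weighted `L¹` bounds of all derivatives that
are uniform in `n`. -/
structure CutoffFamily (d : ℕ) where
  /-- the cut-off function of size `n` -/
  φ : ℕ → Eu d → ℝ
  smooth : ∀ n, ContDiff ℝ ∞ (φ n)
  eq_one : ∀ n ξ, ‖ξ‖ ≤ ((2 : ℝ) ^ n)⁻¹ → φ n ξ = 1
  eq_zero : ∀ n ξ, (2 : ℝ) ^ (n + 1) < ‖ξ‖ → φ n ξ = 0
  bound : ∀ k m : ℕ, ∃ C : ℝ, ∀ n, ∫ ξ, ‖ξ‖ ^ k * ‖iteratedFDeriv ℝ m (φ n) ξ‖ ≤ C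

variable {d : ℕ}

/-- The symbols of the dyadic partition of size `n`: `φ_(n)(ξ)` for `k = 0`, and
`φ_(n)(ξ / 2^k) - φ_(n)(ξ / 2^(k-1))` for `k ≥ 1`. -/
def CutoffFamily.dyadicSymbol (Φ : CutoffFamily d) (n : ℕ) : ℕ → Eu d → ℝ
  | 0, ξ => Φ.φ n ξ
  | k + 1, ξ => Φ.φ n (((2 : ℝ) ^ (k + 1))⁻¹ • ξ) - Φ.φ n (((2 : ℝ) ^ k)⁻¹ • ξ)

/-- The dyadic block `Δ_k` of the partition of size `n`: the Fourier multiplier with symbol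
`dyadicSymbol Φ n k`. The symbol is written for the Fourier transform `∫ e^{-i x·ξ} u(x) dx`, while
Mathlib's transform is `∫ e^{-2 π i x·ξ} u(x) dx`; hence the factor `2 π`. -/
def CutoffFamily.block (Φ : CutoffFamily d) (n k : ℕ) : 𝓢'(Eu d, ℂ) →L[ℂ] 𝓢'(Eu d, ℂ) :=
  fourierMultiplierCLM ℂ (fun ξ : Eu d => (Φ.dyadicSymbol n k ((2 * Real.pi) • ξ) : ℂ))

/-- The function `f` represents the tempered distribution `v`. (Such an `f` is unique up to
equality almost everywhere.) -/
def Represents (f : Eu d → ℂ) (v : 𝓢'(Eu d, ℂ)) : Prop :=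
  ∀ g : 𝓢(Eu d, ℂ), Integrable (fun x => g x * f x) ∧ v g = ∫ x, g x * f x

/-- The `L^p` norm of a tempered distribution; it is `∞` unless the distribution is represented by
a function of class `L^p`. -/
def distLpNorm (p : ℝ≥0∞) (v : 𝓢'(Eu d, ℂ)) : ℝ≥0∞ :=
  ⨅ (f : Eu d → ℂ) (_ : Represents f v), eLpNorm f p volume

/-- The Zygmund norm `sup_q 2^(q s) ‖Δ_q u‖_{L^∞}` taken with the partition of size `n`. The Zygmund
space `C^s_*` consists of the `u` of finite norm. -/
def zygmundNorm (Φ : CutoffFamily d) (n : ℕ) (s : ℝ) (u : 𝓢'(Eu d, ℂ)) : ℝ≥0∞ :=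
  ⨆ q : ℕ, ENNReal.ofReal ((2 : ℝ) ^ ((q : ℝ) * s)) * distLpNorm ∞ (Φ.block n q u)

/-- The Sobolev norm of `H^s`. -/
def sobolevNorm (s : ℝ) (u : 𝓢'(Eu d, ℂ)) : ℝ≥0∞ :=
  distLpNorm 2 (besselPotential (Eu d) ℂ s u)

/-- `w = v ∘ κ`, for a tempered distribution `v` that is a function. -/
def IsComposition (κ : Eu d → Eu d) (v w : 𝓢'(Eu d, ℂ)) : Prop :=
  ∃ f : Eu d → ℂ, Represents f v ∧ Represents (f ∘ κ) w

/-- The piece `[v]_p = ∑_{|j - p| ≤ N} Δ_j v`, `j ≥ 0`, for the partition of size `n`. -/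
def piece (Φ : CutoffFamily d) (n N p : ℕ) (v : 𝓢'(Eu d, ℂ)) : 𝓢'(Eu d, ℂ) :=
  ∑ j ∈ Finset.Icc (p - N) (p + N), Φ.block n j v

/-- `w` is the global paracomposition `κ_g^* u = ∑_{p ≥ 0} [u_p ∘ κ]_p`. Here `u_p = Δ_p u` is taken
with the partition of size `0`, the pieces `[·]_p` have width `N` and are taken with the partition
of size `n`, and the series converges in the space of tempered distributions. -/
def IsGlobalParacomposition (Φ : CutoffFamily d) (n N : ℕ) (κ : Eu d → Eu d)
    (u w : 𝓢'(Eu d, ℂ)) : Prop :=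
  ∃ v : ℕ → 𝓢'(Eu d, ℂ),
    (∀ p, IsComposition κ (Φ.block 0 p u) (v p)) ∧ HasSum (fun p => piece Φ n N p (v p)) w

end Paracomp

end

/-!
By the change of variables formula `|κ⁻¹(A)| ≤ C |A|` for every measurable set `A`, with
`C = 1 / m₀`; such a bound makes `f ↦ f ∘ κ` bounded on every `L^p`. As `[u_p ∘ κ]_p` has its
frequencies in an annulus of size `2^p`, a block `Δ_q` of the sum sees only the boundedly many terms
with `p` close to `q`. For `L^∞` one adds up these terms, the multipliers being convolutions with
kernels of bounded `L¹` norm; for `L²`, Plancherel and this almost orthogonality bound the square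
functions from both sides.

For negative `s` the terms of the series may grow. But for `p > N` their symbols vanish near `0`,
hence are divisible by `|ξ|^(2 M)`, and the `p`-th term is the `M`-th power of the Laplacian applied
to a bounded function of size `O(2^(-p (s + 2 M)))`: with `M` large the series converges in the
sense of distributions.
-/

noncomputable section

namespace Paracomp

open FourierTransform Topology

section ChangeOfVariables

variable {E : Type*} [NormedAddCommGroup E] [NormedSpace ℝ E] [FiniteDimensional ℝ E]
  [MeasurableSpace E] [BorelSpace E]

theorem map_le_smul_of_le_abs_det (μ : Measure E) [μ.IsAddHaarMeasure] {κ : E → E}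
    {κ' : E → E →L[ℝ] E} (hκ : ∀ x, HasFDerivAt κ (κ' x) x) (hinj : Function.Injective κ)
    {m : ℝ≥0} (hm : m ≠ 0) (hdet : ∀ x, (m : ℝ) ≤ |(κ' x).det|) :
    μ.map κ ≤ ((m⁻¹ : ℝ≥0) : ℝ≥0∞) • μ := by
  have hmeas : Measurable κ :=
    (continuous_iff_continuousAt.2 fun x => (hκ x).continuousAt).measurable
  refine Measure.le_iff.2 fun s hs => ?_
  rw [Measure.map_apply hmeas hs, Measure.smul_apply, smul_eq_mul, ENNReal.coe_inv hm,
    ← ENNReal.div_eq_inv_mul, ENNReal.le_div_iff_mul_le (by simp [hm]) (by simp), mul_comm]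
  calc (m : ℝ≥0∞) * μ (κ ⁻¹' s) = ∫⁻ _ in κ ⁻¹' s, m ∂μ := (setLIntegral_const _ _).symm
    _ ≤ ∫⁻ x in κ ⁻¹' s, ENNReal.ofReal |(κ' x).det| ∂μ := lintegral_mono fun x => by
        simpa using ENNReal.ofReal_le_ofReal (hdet x)
    _ = μ (κ '' (κ ⁻¹' s)) := lintegral_abs_det_fderiv_eq_addHaar_image μ (hmeas hs)
        (fun x _ => (hκ x).hasFDerivWithinAt) hinj.injOn
    _ ≤ μ s := measure_mono (Set.image_preimage_subset κ s)

end ChangeOfVariables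

section Distributions

variable {E F : Type*} [NormedAddCommGroup E] [NormedSpace ℝ E] [FiniteDimensional ℝ E]
  [MeasurableSpace E] [BorelSpace E] [NormedAddCommGroup F] [NormedSpace ℂ F] [CompleteSpace F]

theorem toTemperedDistribution_injective {p : ℝ≥0∞} [Fact (1 ≤ p)] {μ : Measure E}
    [μ.HasTemperateGrowth] [IsLocallyFiniteMeasure μ] :
    Function.Injective (Lp.toTemperedDistribution : Lp F p μ → 𝓢'(E, F)) :=
  LinearMap.ker_eq_bot.1 Lp.ker_toTemperedDistributionCLM_eq_bot

end Distributions

variable {d : ℕ}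

section Represents

variable {f f' : Eu d → ℂ} {v : 𝓢'(Eu d, ℂ)} {p : ℝ≥0∞} [hp : Fact (1 ≤ p)]

theorem represents_coe (f : Lp ℂ p (volume : Measure (Eu d))) :
    Represents f (f : 𝓢'(Eu d, ℂ)) := by
  intro g
  have := ENNReal.HolderConjugate.inv_one_sub_inv' hp.out
  refine ⟨?_, by simp⟩
  exact (g.memLp (1 - p⁻¹)⁻¹ volume).integrable_mul (Lp.memLp f)

theorem Represents.congr_ae (hf : Represents f v) (h : f' =ᵐ[volume] f) : Represents f' v := by
  intro g
  have hg : (fun x => g x * f' x) =ᵐ[volume] fun x => g x * f x := by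
    filter_upwards [h] with x hx using by rw [hx]
  exact ⟨(hf g).1.congr hg.symm, (hf g).2.trans (integral_congr_ae hg.symm)⟩

theorem Represents.locallyIntegrable (hf : Represents f v) : LocallyIntegrable f := by
  intro x
  let b : ContDiffBump x := ⟨1, 2, one_pos, one_lt_two⟩
  have hsupp : HasCompactSupport (Complex.ofRealCLM ∘ b) := b.hasCompactSupport.comp_left rfl
  have hsmooth : ContDiff ℝ ∞ (Complex.ofRealCLM ∘ b) := Complex.ofRealCLM.contDiff.comp b.contDiff
  refine ⟨Metric.closedBall x 1, Metric.closedBall_mem_nhds x one_pos, ?_⟩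
  refine (hf (hsupp.toSchwartzMap hsmooth)).1.integrableOn.congr_fun (fun y hy => ?_)
    measurableSet_closedBall
  simp [b.one_of_mem_closedBall hy]

theorem Represents.ae_eq (hf : Represents f v) (hf' : Represents f' v) : f =ᵐ[volume] f' := by
  refine Filter.eventuallyEq_iff_sub.2 <| ae_eq_zero_of_integral_contDiff_smul_eq_zero
    (hf.locallyIntegrable.sub hf'.locallyIntegrable) fun g hg hgc => ?_
  have hsupp : HasCompactSupport (Complex.ofRealCLM ∘ g) := hgc.comp_left rfl
  have hsmooth : ContDiff ℝ ∞ (Complex.ofRealCLM ∘ g) := by fun_prop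
  have h := hf (hsupp.toSchwartzMap hsmooth)
  have h' := hf' (hsupp.toSchwartzMap hsmooth)
  have hsub := integral_sub h.1 h'.1
  rw [← h.2, ← h'.2, sub_self] at hsub
  simpa [mul_sub] using hsub

theorem distLpNorm_coe (f : Lp ℂ p (volume : Measure (Eu d))) :
    distLpNorm p (f : 𝓢'(Eu d, ℂ)) = ‖f‖ₑ := by
  rw [Lp.enorm_def]
  refine le_antisymm (iInf₂_le (f : Eu d → ℂ) (represents_coe f)) (le_iInf₂ fun g hg => ?_)
  exact (eLpNorm_congr_ae ((represents_coe f).ae_eq hg)).le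

theorem exists_eq_coe_of_distLpNorm_lt_top (h : distLpNorm p v < ⊤) :
    ∃ f : Lp ℂ p (volume : Measure (Eu d)), v = f := by
  obtain ⟨f, hf, hlt⟩ := by simpa only [distLpNorm, iInf_lt_iff] using h
  have hm : MemLp f p volume := ⟨hf.locallyIntegrable.aestronglyMeasurable, hlt⟩
  refine ⟨hm.toLp f, ?_⟩
  ext g
  rw [(hf.congr_ae hm.coeFn_toLp g).2, Lp.toTemperedDistribution_apply]
  rfl

end Represents

section Composition

variable {κ : Eu d → Eu d}

theorem exists_isComposition_coe (hκ : Measurable κ) {C : ℝ≥0}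
    (hmap : (volume : Measure (Eu d)).map κ ≤ (C : ℝ≥0∞) • volume) {p : ℝ≥0∞} [Fact (1 ≤ p)]
    (f : Lp ℂ p (volume : Measure (Eu d))) :
    ∃ g : Lp ℂ p (volume : Measure (Eu d)),
      IsComposition κ f (g : 𝓢'(Eu d, ℂ)) ∧ ‖g‖ ≤ (C : ℝ) ^ (1 / p).toReal * ‖f‖ := by
  have hmem : MemLp f p ((volume : Measure (Eu d)).map κ) :=
    (Lp.memLp f).of_measure_le_smul ENNReal.coe_ne_top hmap
  have hcomp : MemLp (f ∘ κ) p volume := hmem.comp_of_map hκ.aemeasurable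
  refine ⟨hcomp.toLp _, ⟨f, represents_coe f,
    (represents_coe _).congr_ae hcomp.coeFn_toLp.symm⟩, ?_⟩
  rw [Lp.norm_toLp, ← eLpNorm_map_measure hmem.1 hκ.aemeasurable, Lp.norm_def]
  have hle : eLpNorm f p ((volume : Measure (Eu d)).map κ) ≤
      (C : ℝ≥0∞) ^ (1 / p).toReal * eLpNorm f p volume := eLpNorm_le_of_measure_le_smul hmap
  have hfin : (C : ℝ≥0∞) ^ (1 / p).toReal * eLpNorm f p volume ≠ ⊤ :=
    ENNReal.mul_ne_top (by simp) (Lp.memLp f).2.ne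
  simpa [ENNReal.toReal_mul, ← ENNReal.toReal_rpow] using ENNReal.toReal_mono hfin hle

theorem IsComposition.unique (hκ : Measure.QuasiMeasurePreserving κ volume volume)
    {v w w' : 𝓢'(Eu d, ℂ)} (h : IsComposition κ v w) (h' : IsComposition κ v w') : w' = w := by
  obtain ⟨f, hf, hfw⟩ := h
  obtain ⟨f', hf', hfw'⟩ := h'
  ext g
  rw [(hfw.congr_ae (hκ.ae_eq_comp (hf'.ae_eq hf)) g).2, (hfw' g).2]

theorem IsGlobalParacomposition.unique (hκ : Measure.QuasiMeasurePreserving κ volume volume)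
    {Φ : CutoffFamily d} {n N : ℕ} {u w w' : 𝓢'(Eu d, ℂ)}
    (h : IsGlobalParacomposition Φ n N κ u w) (h' : IsGlobalParacomposition Φ n N κ u w') :
    w' = w := by
  obtain ⟨v, hv, hs⟩ := h
  obtain ⟨v', hv', hs'⟩ := h'
  obtain rfl : v' = v := funext fun p => (hv p).unique hκ (hv' p)
  exact hs'.unique hs

end Composition

section LpBounded

variable {E F : Type*} [NormedAddCommGroup E] [NormedSpace ℝ E]
  [MeasureSpace E] [BorelSpace E] [(volume : Measure E).HasTemperateGrowth]
  [NormedAddCommGroup F] [NormedSpace ℂ F] [CompleteSpace F]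

/-- The operator `T` on tempered distributions maps `L^p` into itself with norm at most `C`. -/
def IsLpBounded (p : ℝ≥0∞) [Fact (1 ≤ p)] (C : ℝ) (T : 𝓢'(E, F) →L[ℂ] 𝓢'(E, F)) : Prop :=
  ∀ f : Lp F p (volume : Measure E), ∃ g : Lp F p (volume : Measure E),
    T f = g ∧ ‖g‖ ≤ C * ‖f‖

namespace IsLpBounded

variable {p : ℝ≥0∞} [Fact (1 ≤ p)] {C C' : ℝ} {S T : 𝓢'(E, F) →L[ℂ] 𝓢'(E, F)}

theorem mono (hT : IsLpBounded p C T) (h : C ≤ C') : IsLpBounded p C' T := fun f =>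
  let ⟨g, hg, hgf⟩ := hT f
  ⟨g, hg, hgf.trans (by gcongr)⟩

theorem smul (hT : IsLpBounded p C T) (z : ℂ) : IsLpBounded p (‖z‖ * C) (z • T) := fun f => by
  obtain ⟨g, hg, hgf⟩ := hT f
  refine ⟨z • g, ?_, ?_⟩
  · rw [smul_apply, hg]
    exact (map_smul (Lp.toTemperedDistributionCLM F volume p) z g).symm
  · rw [norm_smul, mul_assoc]
    gcongr

theorem comp (hS : IsLpBounded p C S) (hT : IsLpBounded p C' T) (hC : 0 ≤ C) :
    IsLpBounded p (C * C') (S ∘L T) := fun f => by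
  obtain ⟨g, hg, hgf⟩ := hT f
  obtain ⟨h, hh, hhg⟩ := hS g
  refine ⟨h, by rw [ContinuousLinearMap.comp_apply, hg, hh], hhg.trans ?_⟩
  rw [mul_assoc]
  gcongr

theorem sum {ι : Type*} {s : Finset ι} {C : ι → ℝ} {T : ι → 𝓢'(E, F) →L[ℂ] 𝓢'(E, F)}
    (hT : ∀ i ∈ s, IsLpBounded p (C i) (T i)) : IsLpBounded p (∑ i ∈ s, C i) (∑ i ∈ s, T i) := by
  intro f
  have hT' (i : s) := hT i i.2 f
  choose g hg hgf using hT'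
  refine ⟨∑ i, g i, ?_, ?_⟩
  · rw [sum_apply, ← Finset.sum_coe_sort s, ← Lp.toTemperedDistributionCLM_apply (∑ i, g i),
      map_sum]
    exact Finset.sum_congr rfl fun i _ => hg i
  · rw [← Finset.sum_coe_sort s, Finset.sum_mul]
    exact norm_sum_le_of_le _ fun i _ => hgf i

theorem summable_apply {ι : Type*} {T : ι → 𝓢'(E, F) →L[ℂ] 𝓢'(E, F)}
    {f : ι → Lp F p (volume : Measure E)} {a b : ι → ℝ}
    (hT : ∀ k, IsLpBounded p (a k) (T k)) (hf : ∀ k, ‖f k‖ ≤ b k)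
    (ha : ∀ k, 0 ≤ a k) (hab : Summable fun k => a k * b k) :
    Summable fun k => T k (f k) := by
  choose g hg hgf using fun k => hT k (f k)
  have hsum : Summable g := Summable.of_norm_bounded hab fun k =>
    (hgf k).trans (mul_le_mul_of_nonneg_left (hf k) (ha k))
  simp only [hg]
  exact (Lp.toTemperedDistributionCLM F volume p).summable hsum

end IsLpBounded

end LpBounded

section Dilate

variable {E : Type*} [NormedAddCommGroup E] [NormedSpace ℝ E]

/-- The dilate `ξ ↦ σ (c • ξ)` of a Schwartz function. -/
def dilate (c : ℝ) (hc : c ≠ 0) (σ : 𝓢(E, ℂ)) : 𝓢(E, ℂ) :=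
  SchwartzMap.compCLMOfContinuousLinearEquiv ℂ
    (ContinuousLinearEquiv.smulLeft (Units.mk0 c hc) : E ≃L[ℝ] E) σ

@[simp]
theorem dilate_apply (c : ℝ) (hc : c ≠ 0) (σ : 𝓢(E, ℂ)) (ξ : E) :
    dilate c hc σ ξ = σ (c • ξ) := rfl

end Dilate

section Multipliers

variable {E F : Type*} [NormedAddCommGroup E] [InnerProductSpace ℝ E] [FiniteDimensional ℝ E]
  [MeasurableSpace E] [BorelSpace E] [NormedAddCommGroup F] [NormedSpace ℂ F]

theorem fourier_dilate_apply (c : ℝ) (hc : c ≠ 0) (σ : 𝓢(E, ℂ)) (x : E) :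
    𝓕 (dilate c hc σ) x = |(c ^ Module.finrank ℝ E)⁻¹| • 𝓕 σ (c⁻¹ • x) := by
  simp only [SchwartzMap.fourier_coe, Real.fourier_eq]
  rw [← Measure.integral_comp_smul volume
    (fun v => Real.fourierChar (-inner ℝ v (c⁻¹ • x)) • σ v) c]
  refine integral_congr_ae (.of_forall fun v => ?_)
  simp [inner_smul_left, inner_smul_right, hc]

theorem integral_norm_fourier_dilate (c : ℝ) (hc : c ≠ 0) (σ : 𝓢(E, ℂ)) :
    ∫ x, ‖𝓕 (dilate c hc σ) x‖ = ∫ x, ‖𝓕 σ x‖ := by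
  simp only [fourier_dilate_apply, norm_smul, norm_abs_eq_norm]
  rw [integral_const_mul, Measure.integral_comp_smul volume (fun x => ‖𝓕 σ x‖) c⁻¹,
    smul_eq_mul, ← mul_assoc, Real.norm_eq_abs, ← abs_mul, inv_pow, inv_inv,
    inv_mul_cancel₀ (pow_ne_zero _ hc), abs_one, one_mul]

theorem fourier_smulLeftCLM_fourierInv_apply (σ g : 𝓢(E, ℂ)) (x : E) :
    𝓕 (SchwartzMap.smulLeftCLM ℂ σ (𝓕⁻ g)) x = ∫ y, 𝓕 σ (x - y) * g y := by
  have hinv (f : 𝓢(E, ℂ)) (ξ : E) : 𝓕⁻ f ξ = 𝓕 f (-ξ) := by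
    simp [SchwartzMap.fourierInv_apply_eq]
  have hconv : SchwartzMap.smulLeftCLM ℂ σ (𝓕⁻ g) =
      𝓕⁻ (SchwartzMap.convolution (ContinuousLinearMap.mul ℂ ℂ) (𝓕 σ) g) := by
    ext ξ
    rw [hinv, SchwartzMap.fourier_convolution, SchwartzMap.pairing_apply_apply, ← hinv, ← hinv,
      SchwartzMap.smulLeftCLM_apply_apply σ.hasTemperateGrowth]
    simp
  rw [hconv, FourierTransform.fourier_fourierInv_eq, SchwartzMap.convolution_apply,
    ← MeasureTheory.convolution_flip]
  rfl

theorem norm_integral_smul_le_of_ae_norm_le {α : Type*} [MeasurableSpace α] {μ : Measure α}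
    {k : α → ℂ} {f : α → F} {C : ℝ} (hk : Integrable k μ) (hf : ∀ᵐ x ∂μ, ‖f x‖ ≤ C) :
    ‖∫ x, k x • f x ∂μ‖ ≤ (∫ x, ‖k x‖ ∂μ) * C := by
  rw [← integral_mul_const]
  refine norm_integral_le_of_norm_le (hk.norm.mul_const _) ?_
  filter_upwards [hf] with x hx
  rw [norm_smul]
  gcongr

theorem norm_integral_sub_smul_le {k : E → ℂ} {f : E → F} {C : ℝ} (hk : Integrable k)
    (hf : ∀ᵐ x, ‖f x‖ ≤ C) (y : E) : ‖∫ x, k (x - y) • f x‖ ≤ (∫ x, ‖k x‖) * C := by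
  rw [← integral_sub_right_eq_self (fun x => ‖k x‖) y]
  exact norm_integral_smul_le_of_ae_norm_le (hk.comp_sub_right y) hf

theorem memLp_top_integral_sub_smul {k : E → ℂ} {f : E → F} {C : ℝ} (hk : Integrable k)
    (hf : AEStronglyMeasurable f) (hfC : ∀ᵐ x, ‖f x‖ ≤ C) :
    MemLp (fun y => ∫ x, k (x - y) • f x) ⊤ := by
  refine memLp_top_of_bound (AEStronglyMeasurable.integral_prod_right'
    (f := fun z : E × E => k (z.2 - z.1) • f z.2) ?_) _
    (.of_forall (norm_integral_sub_smul_le hk hfC))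
  have hsub : Measure.QuasiMeasurePreserving (fun z : E × E => z.2 - z.1)
      (volume.prod volume) volume :=
    (quasiMeasurePreserving_sub volume volume).comp
      Measure.measurePreserving_swap.quasiMeasurePreserving
  exact (hk.aestronglyMeasurable.comp_quasiMeasurePreserving hsub).smul hf.comp_snd

theorem integral_integral_sub_mul_smul [CompleteSpace F] {k g : E → ℂ} {f : E → F} {C : ℝ}
    (hk : Integrable k) (hg : Integrable g) (hf : AEStronglyMeasurable f)
    (hfC : ∀ᵐ x, ‖f x‖ ≤ C) :
    ∫ x, (∫ y, k (x - y) * g y) • f x = ∫ y, g y • ∫ x, k (x - y) • f x := by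
  have hint : Integrable (fun z : E × E => (g z.2 * k (z.1 - z.2)) • f z.1)
      (volume.prod volume) :=
    (hg.convolution_integrand (ContinuousLinearMap.mul ℂ ℂ) hk).smul_bdd C hf.comp_fst
      (Measure.quasiMeasurePreserving_fst.ae hfC)
  calc ∫ x, (∫ y, k (x - y) * g y) • f x
      = ∫ x, ∫ y, (g y * k (x - y)) • f x := by simp only [integral_smul_const, mul_comm]
    _ = ∫ y, ∫ x, (g y * k (x - y)) • f x := integral_integral_swap hint
    _ = ∫ y, g y • ∫ x, k (x - y) • f x := by simp only [mul_smul, integral_smul]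

variable [CompleteSpace F]

theorem isLpBounded_top_fourierMultiplierCLM (σ : 𝓢(E, ℂ)) :
    IsLpBounded ⊤ (∫ x, ‖𝓕 σ x‖) (fourierMultiplierCLM F σ) := by
  intro f
  have hf : ∀ᵐ x, ‖f x‖ ≤ ‖f‖ := by
    simpa only [Lp.norm_def, toReal_eLpNorm (Lp.memLp f).1] using
      ae_le_lpNorm_exponent_top (Lp.memLp f)
  have hk : Integrable (𝓕 σ : 𝓢(E, ℂ)) := (𝓕 σ).integrable
  have hmem := memLp_top_integral_sub_smul hk (Lp.memLp f).1 hf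
  refine ⟨hmem.toLp _, ?_, ?_⟩
  · ext g
    rw [fourierMultiplierCLM_apply_apply, Lp.toTemperedDistribution_apply,
      Lp.toTemperedDistribution_apply]
    simp only [fourier_smulLeftCLM_fourierInv_apply]
    rw [integral_integral_sub_mul_smul hk g.integrable (Lp.memLp f).1 hf]
    refine integral_congr_ae ?_
    filter_upwards [hmem.coeFn_toLp] with y hy using by rw [hy]
  · rw [Lp.norm_toLp, eLpNorm_exponent_top]
    exact ENNReal.toReal_le_of_le_ofReal (by positivity)
      (eLpNormEssSup_le_of_ae_bound (.of_forall (norm_integral_sub_smul_le hk hf)))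

theorem isLpBounded_top_fourierMultiplierCLM_dilate (σ : 𝓢(E, ℂ)) {c : ℝ} (hc : c ≠ 0) :
    IsLpBounded ⊤ (∫ x, ‖𝓕 σ x‖) (fourierMultiplierCLM F (dilate c hc σ)) :=
  integral_norm_fourier_dilate c hc σ ▸ isLpBounded_top_fourierMultiplierCLM (dilate c hc σ)

end Multipliers

section DyadicSums

theorem card_Icc_sub_add_le (p N : ℕ) : (Finset.Icc (p - N) (p + N)).card ≤ 2 * N + 1 := by
  rw [Nat.card_Icc]
  omega

theorem norm_sum_Icc_sub_add_le {V : Type*} [SeminormedAddCommGroup V] {p N : ℕ} {x : ℕ → V}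
    {c : ℝ} (hc : 0 ≤ c) (hx : ∀ j ∈ Finset.Icc (p - N) (p + N), ‖x j‖ ≤ c) :
    ‖∑ j ∈ Finset.Icc (p - N) (p + N), x j‖ ≤ (2 * N + 1) * c := by
  refine (norm_sum_le_of_le _ hx).trans ?_
  rw [Finset.sum_const, nsmul_eq_mul]
  gcongr
  exact_mod_cast card_Icc_sub_add_le p N

theorem rpow_mul_rpow_neg_le {c t u : ℝ} (ht : 0 < t) (hu : 0 < u) (htu : t ≤ c * u)
    (hut : u ≤ c * t) (s : ℝ) : t ^ s * u ^ (-s) ≤ c ^ |s| := by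
  rcases le_total 0 s with hs | hs
  · rw [abs_of_nonneg hs, Real.rpow_neg hu.le, ← div_eq_mul_inv, ← Real.div_rpow ht.le hu.le]
    exact Real.rpow_le_rpow (by positivity) ((div_le_iff₀ hu).2 htu) hs
  · rw [abs_of_nonpos hs, ← neg_neg s, Real.rpow_neg ht.le, neg_neg, mul_comm, ← div_eq_mul_inv,
      ← Real.div_rpow hu.le ht.le]
    exact Real.rpow_le_rpow (by positivity) ((div_le_iff₀ ht).2 hut) (neg_nonneg.2 hs)

theorem two_rpow_neg_mul_le {p q T : ℕ} (hp : p ∈ Finset.Icc (q - T) (q + T)) (s : ℝ) :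
    (2 : ℝ) ^ (-(p * s)) ≤ 2 ^ (T * |s|) * 2 ^ (-(q * s)) := by
  have hpq : q ≤ T + p ∧ p ≤ T + q := by rw [Finset.mem_Icc] at hp; omega
  have h := rpow_mul_rpow_neg_le (c := (2 : ℝ) ^ T) (t := 2 ^ q) (u := 2 ^ p) (by positivity)
    (by positivity) (by rw [← pow_add]; gcongr; exacts [one_le_two, hpq.1])
    (by rw [← pow_add]; gcongr; exacts [one_le_two, hpq.2]) s
  simp only [← Real.rpow_natCast_mul two_pos.le] at h
  rw [Real.rpow_neg two_pos.le (q * s), ← div_eq_mul_inv, le_div_iff₀ (by positivity), mul_comm]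
  simpa only [mul_neg] using h

end DyadicSums

/-- A family of symbols `a p`, bounded by `B`, which live on the frequencies `ξ` with
`(1 + ‖ξ‖²)^{1/2}` between `2^(p - R)` and `2^(p + R)`. -/
structure IsDyadic {E : Type*} [NormedAddCommGroup E] [NormedSpace ℝ E] (R : ℕ) (B : ℝ)
    (a : ℕ → E → ℂ) : Prop where
  hasTemperateGrowth : ∀ p, (a p).HasTemperateGrowth
  norm_le : ∀ p ξ, ‖a p ξ‖ ≤ B
  two_pow_le : ∀ p ξ, a p ξ ≠ 0 → (2 : ℝ) ^ p ≤ 2 ^ R * √(1 + ‖ξ‖ ^ 2)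
  le_two_pow : ∀ p ξ, a p ξ ≠ 0 → √(1 + ‖ξ‖ ^ 2) ≤ 2 ^ R * 2 ^ p

namespace IsDyadic

section NormedSpace

variable {E : Type*} [NormedAddCommGroup E] [NormedSpace ℝ E] {R R' : ℕ} {B B' : ℝ}
  {a b : ℕ → E → ℂ}

theorem nonneg (ha : IsDyadic R B a) : 0 ≤ B := (norm_nonneg _).trans (ha.norm_le 0 0)

theorem congr (ha : IsDyadic R B a) (h : ∀ p ξ, b p ξ = a p ξ) : IsDyadic R B b := by
  obtain rfl : b = a := funext fun p => funext (h p)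
  exact ha

theorem hasCompactSupport [ProperSpace E] (ha : IsDyadic R B a) (p : ℕ) :
    HasCompactSupport (a p) := by
  refine .intro (isCompact_closedBall 0 (2 ^ R * 2 ^ p)) fun ξ hξ => ?_
  contrapose! hξ
  refine mem_closedBall_zero_iff.2 (le_trans ?_ (ha.le_two_pow p ξ hξ))
  exact Real.le_sqrt_of_sq_le (by simp)

theorem le_add (ha : IsDyadic R B a) (hb : IsDyadic R' B' b) {p q : ℕ} {ξ : E}
    (hp : a p ξ ≠ 0) (hq : b q ξ ≠ 0) : p ≤ q + (R + R') := by
  have h : (2 : ℝ) ^ p ≤ 2 ^ (q + (R + R')) := by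
    calc (2 : ℝ) ^ p ≤ 2 ^ R * √(1 + ‖ξ‖ ^ 2) := ha.two_pow_le p ξ hp
      _ ≤ 2 ^ R * (2 ^ R' * 2 ^ q) := by gcongr; exact hb.le_two_pow q ξ hq
      _ = 2 ^ (q + (R + R')) := by ring
  exact (pow_le_pow_iff_right₀ one_lt_two).1 h

theorem mem_Icc (ha : IsDyadic R B a) (hb : IsDyadic R' B' b) {p q : ℕ} {ξ : E}
    (hp : a p ξ ≠ 0) (hq : b q ξ ≠ 0) : p ∈ Finset.Icc (q - (R + R')) (q + (R + R')) := by
  have h := ha.le_add hb hp hq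
  have h' := hb.le_add ha hq hp
  rw [Finset.mem_Icc]
  omega

theorem sum_norm_sq_le (ha : IsDyadic R B a) (P : Finset ℕ) (ξ : E) :
    ∑ p ∈ P, ‖a p ξ‖ ^ 2 ≤ (2 * ↑(R + R) + 1) * B ^ 2 := by
  by_cases h : ∃ q, a q ξ ≠ 0
  · obtain ⟨q, hq⟩ := h
    set I := Finset.Icc (q - (R + R)) (q + (R + R))
    calc ∑ p ∈ P, ‖a p ξ‖ ^ 2 = ∑ p ∈ P with p ∈ I, ‖a p ξ‖ ^ 2 :=
        (Finset.sum_filter_of_ne fun p _ hp => ha.mem_Icc ha (by simpa using hp) hq).symm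
      _ ≤ ∑ p ∈ I, ‖a p ξ‖ ^ 2 := Finset.sum_le_sum_of_subset_of_nonneg
        (fun p hp => (Finset.mem_filter.1 hp).2) fun p _ _ => by positivity
      _ ≤ ‖∑ p ∈ I, ‖a p ξ‖ ^ 2‖ := Real.le_norm_self _
      _ ≤ _ := norm_sum_Icc_sub_add_le (by positivity) fun p _ => by
        rw [norm_pow, norm_norm]
        gcongr
        exact ha.norm_le p ξ
  · push Not at h
    simp only [h, norm_zero, ne_eq, OfNat.ofNat_ne_zero, not_false_eq_true, zero_pow,
      Finset.sum_const_zero]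
    positivity

theorem sum_Icc (ha : IsDyadic R B a) (N : ℕ) :
    IsDyadic (R + N) ((2 * N + 1) * B)
      (fun p ξ => ∑ j ∈ Finset.Icc (p - N) (p + N), a j ξ) where
  hasTemperateGrowth p := Function.HasTemperateGrowth.sum fun j _ => ha.hasTemperateGrowth j
  norm_le p ξ := norm_sum_Icc_sub_add_le ha.nonneg fun j _ => ha.norm_le j ξ
  two_pow_le p ξ h := by
    obtain ⟨j, hj, hne⟩ := Finset.exists_ne_zero_of_sum_ne_zero h
    rw [Finset.mem_Icc] at hj
    calc (2 : ℝ) ^ p ≤ 2 ^ (N + j) := pow_le_pow_right₀ one_le_two (by omega)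
      _ = 2 ^ N * 2 ^ j := pow_add _ _ _
      _ ≤ 2 ^ N * (2 ^ R * √(1 + ‖ξ‖ ^ 2)) := by gcongr; exact ha.two_pow_le j ξ hne
      _ = 2 ^ (R + N) * √(1 + ‖ξ‖ ^ 2) := by ring
  le_two_pow p ξ h := by
    obtain ⟨j, hj, hne⟩ := Finset.exists_ne_zero_of_sum_ne_zero h
    rw [Finset.mem_Icc] at hj
    calc √(1 + ‖ξ‖ ^ 2) ≤ 2 ^ R * 2 ^ j := ha.le_two_pow j ξ hne
      _ ≤ 2 ^ R * 2 ^ (p + N) := by gcongr; exacts [one_le_two, hj.2]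
      _ = 2 ^ (R + N) * 2 ^ p := by ring

end NormedSpace

section InnerProductSpace

variable {E : Type*} [NormedAddCommGroup E] [InnerProductSpace ℝ E] {R : ℕ} {B : ℝ}
  {a : ℕ → E → ℂ}

theorem weighted (ha : IsDyadic R B a) (s : ℝ) :
    IsDyadic R (2 ^ (R * |s|) * B)
      (fun p ξ => (((2 : ℝ) ^ (p * s) : ℝ) : ℂ) *
        ((((1 + ‖ξ‖ ^ 2) ^ (-s / 2) : ℝ) : ℂ) * a p ξ)) where
  hasTemperateGrowth p := by
    have h := ha.hasTemperateGrowth p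
    fun_prop
  norm_le p ξ := by
    by_cases h0 : a p ξ = 0
    · have := ha.nonneg
      rw [h0, mul_zero, mul_zero, norm_zero]
      positivity
    rw [← mul_assoc, norm_mul]
    refine mul_le_mul ?_ (ha.norm_le p ξ) (norm_nonneg _) (by positivity)
    rw [← Complex.ofReal_mul, Complex.norm_real, Real.norm_of_nonneg (by positivity)]
    have hweight := rpow_mul_rpow_neg_le (by positivity) (by positivity)
      (ha.two_pow_le p ξ h0) (ha.le_two_pow p ξ h0) s
    rwa [Real.sqrt_eq_rpow, ← Real.rpow_mul (by positivity), one_div_mul_eq_div,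
      ← Real.rpow_natCast_mul two_pos.le, ← Real.rpow_natCast_mul two_pos.le] at hweight
  two_pow_le p ξ h := ha.two_pow_le p ξ (right_ne_zero_of_mul (right_ne_zero_of_mul h))
  le_two_pow p ξ h := ha.le_two_pow p ξ (right_ne_zero_of_mul (right_ne_zero_of_mul h))

end InnerProductSpace

end IsDyadic

section DyadicDilates

variable {E : Type*} [NormedAddCommGroup E] [NormedSpace ℝ E]

/-- The symbols of a Littlewood-Paley decomposition: `σ₀` for the low frequencies, followed by the
dilates `ξ ↦ σ (ξ / 2^k)`, `k ≥ 1`. -/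
def dyadicDilates (σ₀ σ : 𝓢(E, ℂ)) : ℕ → 𝓢(E, ℂ)
  | 0 => σ₀
  | k + 1 => dilate ((2 ^ (k + 1))⁻¹) (by positivity) σ

theorem dyadicDilates_apply_of_pos (σ₀ σ : 𝓢(E, ℂ)) {k : ℕ} (hk : 0 < k) (ξ : E) :
    dyadicDilates σ₀ σ k ξ = σ (((2 : ℝ) ^ k)⁻¹ • ξ) := by
  obtain ⟨k, rfl⟩ := Nat.exists_eq_add_of_lt hk
  simp [dyadicDilates]

theorem sqrt_one_add_sq_le_one_add {t : ℝ} (ht : 0 ≤ t) : √(1 + t ^ 2) ≤ 1 + t := by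
  rw [Real.sqrt_le_left (by positivity)]
  nlinarith

theorem isDyadic_dyadicDilates {σ₀ σ : 𝓢(E, ℂ)} {r : ℕ} (hσ₀ : ∀ ξ, σ₀ ξ ≠ 0 → ‖ξ‖ ≤ 2 ^ r)
    (hσ : ∀ ξ, σ ξ ≠ 0 → (2 ^ r)⁻¹ ≤ ‖ξ‖ ∧ ‖ξ‖ ≤ 2 ^ r) :
    IsDyadic (r + 1) (max (SchwartzMap.seminorm ℝ 0 0 σ₀) (SchwartzMap.seminorm ℝ 0 0 σ))
      (fun k => dyadicDilates σ₀ σ k) := by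
  have hle (k : ℕ) (ξ : E) (h : dyadicDilates σ₀ σ k ξ ≠ 0) : ‖ξ‖ ≤ 2 ^ r * 2 ^ k := by
    rcases k with _ | k
    · simpa using hσ₀ ξ h
    have := (hσ (((2 : ℝ) ^ (k + 1))⁻¹ • ξ) h).2
    rwa [norm_smul, norm_inv, norm_pow, Real.norm_two, inv_mul_le_iff₀ (by positivity),
      mul_comm] at this
  refine ⟨fun k => (dyadicDilates σ₀ σ k).hasTemperateGrowth, fun k ξ => ?_, fun k ξ h => ?_,
    fun k ξ h => ?_⟩
  · rcases k with _ | k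
    · exact le_max_of_le_left (SchwartzMap.norm_le_seminorm ℝ σ₀ ξ)
    · exact le_max_of_le_right (SchwartzMap.norm_le_seminorm ℝ σ _)
  · have hsqrt : 1 ≤ √(1 + ‖ξ‖ ^ 2) ∧ ‖ξ‖ ≤ √(1 + ‖ξ‖ ^ 2) :=
      ⟨Real.one_le_sqrt.2 (by simp), Real.le_sqrt_of_sq_le (by simp)⟩
    rcases k with _ | k
    · exact one_le_mul_of_one_le_of_one_le (one_le_pow₀ one_le_two) hsqrt.1
    have := (hσ (((2 : ℝ) ^ (k + 1))⁻¹ • ξ) h).1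
    rw [norm_smul, norm_inv, norm_pow, Real.norm_two, inv_mul_eq_div, le_div_iff₀ (by positivity),
      inv_mul_le_iff₀ (by positivity)] at this
    calc (2 : ℝ) ^ (k + 1) ≤ 2 ^ r * ‖ξ‖ := this
      _ ≤ 2 ^ (r + 1) * √(1 + ‖ξ‖ ^ 2) := by
        gcongr
        exacts [one_le_two, r.le_succ, hsqrt.2]
  · calc √(1 + ‖ξ‖ ^ 2) ≤ 1 + ‖ξ‖ := sqrt_one_add_sq_le_one_add (norm_nonneg ξ)
      _ ≤ 2 ^ r * 2 ^ k + 2 ^ r * 2 ^ k := add_le_add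
        (one_le_mul_of_one_le_of_one_le (one_le_pow₀ one_le_two) (one_le_pow₀ one_le_two))
        (hle k ξ h)
      _ = 2 ^ (r + 1) * 2 ^ k := by ring

theorem sum_Icc_dyadicDilates_add (σ₀ σ : 𝓢(E, ℂ)) (N p : ℕ) :
    ∑ j ∈ Finset.Icc (p + (N + 1) - N) (p + (N + 1) + N), dyadicDilates σ₀ σ j =
      dilate ((2 ^ p)⁻¹) (by positivity)
        (∑ j ∈ Finset.Icc (N + 1 - N) (N + 1 + N), dyadicDilates σ₀ σ j) := by
  ext ξ
  have hIcc : Finset.Icc (p + (N + 1) - N) (p + (N + 1) + N) =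
      (Finset.Icc (N + 1 - N) (N + 1 + N)).map (addRightEmbedding p) := by
    rw [Finset.map_add_right_Icc]
    congr 1 <;> omega
  rw [hIcc, Finset.sum_map, sum_apply, dilate_apply, sum_apply]
  refine Finset.sum_congr rfl fun j hj => ?_
  have hj : 0 < j := by rw [Finset.mem_Icc] at hj; omega
  rw [addRightEmbedding_apply, dyadicDilates_apply_of_pos _ _ hj,
    dyadicDilates_apply_of_pos _ _ (by omega), smul_smul, pow_add, mul_inv]

end DyadicDilates

section NormPow

variable {E : Type*} [NormedAddCommGroup E] [InnerProductSpace ℝ E]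

theorem hasTemperateGrowth_norm_sq_pow (M : ℕ) :
    (fun ξ : E => (((‖ξ‖ ^ 2) ^ M : ℝ) : ℂ)).HasTemperateGrowth :=
  Function.HasTemperateGrowth.comp Function.Complex.hasTemperateGrowth_ofReal
    ((Function.hasTemperateGrowth_norm_sq E).pow M)

theorem exists_eq_norm_sq_pow_mul {σ : 𝓢(E, ℂ)} (hσ : HasCompactSupport σ) (hσ₀ : σ =ᶠ[𝓝 0] 0)
    (M : ℕ) : ∃ τ : 𝓢(E, ℂ), ∀ ξ, σ ξ = ((‖ξ‖ ^ 2) ^ M : ℝ) * τ ξ := by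
  have hpos {ξ : E} (hξ : ξ ≠ 0) : (((‖ξ‖ ^ 2) ^ M : ℝ) : ℂ) ≠ 0 := by simp [hξ]
  have hsupp : HasCompactSupport fun ξ => (((‖ξ‖ ^ 2) ^ M : ℝ) : ℂ)⁻¹ * σ ξ := hσ.mul_left
  have hsmooth : ContDiff ℝ ∞ fun ξ => (((‖ξ‖ ^ 2) ^ M : ℝ) : ℂ)⁻¹ * σ ξ := by
    refine contDiff_iff_contDiffAt.2 fun ξ => ?_
    rcases eq_or_ne ξ 0 with rfl | hξ
    · refine (contDiffAt_const (c := (0 : ℂ))).congr_of_eventuallyEq ?_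
      filter_upwards [hσ₀] with ξ hξ using by rw [hξ, Pi.zero_apply, mul_zero]
    · have hnorm : ContDiff ℝ ∞ fun ξ : E => (((‖ξ‖ ^ 2) ^ M : ℝ) : ℂ) :=
        Complex.ofRealCLM.contDiff.comp ((contDiff_norm_sq ℝ).pow M)
      exact (hnorm.contDiffAt.inv (hpos hξ)).mul (σ.smooth ⊤).contDiffAt
  refine ⟨hsupp.toSchwartzMap hsmooth, fun ξ => ?_⟩
  rw [HasCompactSupport.toSchwartzMap_toFun]
  rcases eq_or_ne ξ 0 with rfl | hξ
  · rw [hσ₀.eq_of_nhds, Pi.zero_apply, mul_zero, mul_zero]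
  · rw [mul_inv_cancel_left₀ (hpos hξ)]

end NormPow

section Summability

variable {E F : Type*} [NormedAddCommGroup E] [InnerProductSpace ℝ E] [FiniteDimensional ℝ E]
  [MeasurableSpace E] [BorelSpace E] [NormedAddCommGroup F] [NormedSpace ℂ F]

theorem fourierMultiplierCLM_dilate_eq_comp {σ τ : 𝓢(E, ℂ)} {M : ℕ}
    (hτ : ∀ ξ, σ ξ = ((‖ξ‖ ^ 2) ^ M : ℝ) * τ ξ) {c : ℝ} (hc : c ≠ 0) :
    fourierMultiplierCLM F (dilate c hc σ) =
      fourierMultiplierCLM F (fun ξ => (((‖ξ‖ ^ 2) ^ M : ℝ) : ℂ)) ∘L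
        (((c ^ (2 * M) : ℝ) : ℂ) • fourierMultiplierCLM F (dilate c hc τ)) := by
  have hg := hasTemperateGrowth_norm_sq_pow (E := E) M
  have hτg := (dilate c hc τ).hasTemperateGrowth
  rw [ContinuousLinearMap.comp_smul, fourierMultiplierCLM_compL_fourierMultiplierCLM hτg hg,
    ← fourierMultiplierCLM_smul (hτg.mul hg)]
  congr 1
  ext ξ
  simp only [dilate_apply, hτ, norm_smul, Real.norm_eq_abs, mul_pow, sq_abs, pow_mul,
    Pi.smul_apply, Pi.mul_apply, smul_eq_mul, Complex.ofReal_mul]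
  ring

variable [CompleteSpace F]

/-- The factor `‖ξ‖^(2M)` of `σ` gives the `p`-th term the decay `2^(-2Mp)`, which compensates the
growth of `V` when `s` is negative. -/
theorem summable_fourierMultiplierCLM_dilate {σ : 𝓢(E, ℂ)} (hσ : HasCompactSupport σ)
    (hσ₀ : σ =ᶠ[𝓝 0] 0) {A s : ℝ} {V : ℕ → Lp F ⊤ (volume : Measure E)}
    (hV : ∀ p : ℕ, ‖V p‖ ≤ A * 2 ^ (-(p * s))) :
    Summable fun p : ℕ =>
      fourierMultiplierCLM F (dilate ((2 ^ p)⁻¹) (by positivity) σ) (V p : 𝓢'(E, F)) := by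
  obtain ⟨M, hM⟩ := exists_nat_gt (-s)
  obtain ⟨τ, hτ⟩ := exists_eq_norm_sq_pow_mul hσ hσ₀ M
  have hdecay (p : ℕ) : ‖((((2 ^ p)⁻¹ ^ (2 * M) : ℝ)) : ℂ)‖ * (∫ x, ‖𝓕 τ x‖) *
      (A * 2 ^ (-(p * s))) = (∫ x, ‖𝓕 τ x‖) * A * ((2 : ℝ) ^ (-(2 * M + s))) ^ p := by
    have hpow : ((2 : ℝ) ^ p)⁻¹ ^ (2 * M) = 2 ^ (-(p * (2 * M) : ℝ)) := by
      rw [Real.rpow_neg two_pos.le, inv_pow, ← pow_mul, ← Real.rpow_natCast]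
      norm_cast
    rw [Complex.norm_real, Real.norm_of_nonneg (by positivity), hpow,
      ← Real.rpow_mul_natCast two_pos.le, neg_mul, add_mul, neg_add, Real.rpow_add two_pos,
      mul_comm s, mul_comm (p : ℝ) (2 * M)]
    ring
  have hsum : Summable fun p : ℕ => ‖((((2 ^ p)⁻¹ ^ (2 * M) : ℝ)) : ℂ)‖ * (∫ x, ‖𝓕 τ x‖) *
      (A * 2 ^ (-(p * s))) := by
    simp only [hdecay]
    refine (summable_geometric_of_lt_one (by positivity) ?_).mul_left _
    refine Real.rpow_lt_one_of_one_lt_of_neg one_lt_two ?_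
    linarith [M.cast_nonneg (α := ℝ)]
  have h := IsLpBounded.summable_apply (fun p : ℕ =>
    (isLpBounded_top_fourierMultiplierCLM_dilate (F := F) τ
      (by positivity : ((2 : ℝ) ^ p)⁻¹ ≠ 0)).smul (((2 ^ p)⁻¹ ^ (2 * M) : ℝ) : ℂ)) hV
    (fun p => by positivity) hsum
  simp only [fourierMultiplierCLM_dilate_eq_comp hτ, ContinuousLinearMap.comp_apply]
  exact ContinuousLinearMap.summable _ h

theorem exists_isLpBounded_top_dyadicDilates (σ₀ σ : 𝓢(E, ℂ)) :
    ∃ C, 0 ≤ C ∧ ∀ k, IsLpBounded ⊤ C (fourierMultiplierCLM F (dyadicDilates σ₀ σ k)) := by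
  refine ⟨max (∫ x, ‖𝓕 σ₀ x‖) (∫ x, ‖𝓕 σ x‖), by positivity, fun k => ?_⟩
  rcases k with _ | k
  · exact (isLpBounded_top_fourierMultiplierCLM σ₀).mono (le_max_left _ _)
  · exact (isLpBounded_top_fourierMultiplierCLM_dilate σ _).mono (le_max_right _ _)

end Summability

section AlmostOrthogonality

variable {E F : Type*} [NormedAddCommGroup E] [InnerProductSpace ℝ E] [FiniteDimensional ℝ E]
  [MeasurableSpace E] [BorelSpace E] [NormedAddCommGroup F] [NormedSpace ℂ F]

theorem fourierMultiplierCLM_eq_zero_of_mul_eq_zero {a b : E → ℂ} (ha : a.HasTemperateGrowth)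
    (hb : b.HasTemperateGrowth) (hab : a * b = 0) (v : 𝓢'(E, F)) :
    fourierMultiplierCLM F b (fourierMultiplierCLM F a v) = 0 := by
  rw [fourierMultiplierCLM_fourierMultiplierCLM_apply ha hb, hab, Pi.zero_def,
    fourierMultiplierCLM_const, zero_smul, zero_apply]

namespace IsDyadic

variable {R R' : ℕ} {B B' : ℝ} {a b : ℕ → E → ℂ}

theorem fourierMultiplierCLM_eq_sum (ha : IsDyadic R B a) (hb : IsDyadic R' B' b)
    {v : ℕ → 𝓢'(E, F)} {w : 𝓢'(E, F)}
    (hw : HasSum (fun p => fourierMultiplierCLM F (b p) (v p)) w) (q : ℕ) :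
    fourierMultiplierCLM F (a q) w = ∑ p ∈ Finset.Icc (q - (R' + R)) (q + (R' + R)),
      fourierMultiplierCLM F (a q) (fourierMultiplierCLM F (b p) (v p)) := by
  refine (hw.mapL (fourierMultiplierCLM F (a q))).unique (hasSum_sum_of_ne_finset_zero ?_)
  refine fun p hp => fourierMultiplierCLM_eq_zero_of_mul_eq_zero (hb.hasTemperateGrowth p)
    (ha.hasTemperateGrowth q) (funext fun ξ => ?_) (v p)
  contrapose! hp
  exact hb.mem_Icc ha (left_ne_zero_of_mul hp) (right_ne_zero_of_mul hp)

theorem exists_norm_fourierMultiplierCLM_le [CompleteSpace F] (ha : IsDyadic R B a)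
    (hb : IsDyadic R' B' b) {r : ℝ≥0∞} [Fact (1 ≤ r)] {C C' : ℝ} (hC : 0 ≤ C) (hC' : 0 ≤ C')
    (haC : ∀ q, IsLpBounded r C (fourierMultiplierCLM F (a q)))
    (hbC : ∀ p, IsLpBounded r C' (fourierMultiplierCLM F (b p))) {A s : ℝ}
    {V : ℕ → Lp F r (volume : Measure E)} (hV : ∀ p : ℕ, ‖V p‖ ≤ A * 2 ^ (-(p * s)))
    {w : 𝓢'(E, F)} (hw : HasSum (fun p => fourierMultiplierCLM F (b p) (V p : 𝓢'(E, F))) w)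
    (q : ℕ) : ∃ G : Lp F r (volume : Measure E), fourierMultiplierCLM F (a q) w = G ∧
      ‖G‖ ≤ (2 * ↑(R' + R) + 1) * (C * C' * 2 ^ (↑(R' + R) * |s|)) * A * 2 ^ (-(q * s)) := by
  have hA : 0 ≤ A := nonneg_of_mul_nonneg_left ((norm_nonneg _).trans (hV 0)) (by positivity)
  choose G hG hGV using fun p => (haC q).comp (hbC p) hC (V p)
  refine ⟨∑ p ∈ Finset.Icc (q - (R' + R)) (q + (R' + R)), G p, ?_, ?_⟩
  · rw [ha.fourierMultiplierCLM_eq_sum hb hw, ← Lp.toTemperedDistributionCLM_apply, map_sum]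
    exact Finset.sum_congr rfl fun p _ => hG p
  · refine (norm_sum_Icc_sub_add_le (c := C * C' * (A * (2 ^ (↑(R' + R) * |s|) * 2 ^ (-(q * s)))))
      (by positivity) fun p hp => ?_).trans_eq (by ring)
    calc ‖G p‖ ≤ C * C' * ‖V p‖ := hGV p
      _ ≤ C * C' * (A * 2 ^ (-(p * s))) := by gcongr; exact hV p
      _ ≤ C * C' * (A * (2 ^ (↑(R' + R) * |s|) * 2 ^ (-(q * s)))) := by
        gcongr
        exact two_rpow_neg_mul_le hp s

end IsDyadic

end AlmostOrthogonality

section PieceSymbols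

variable {E : Type*} [NormedAddCommGroup E] [NormedSpace ℝ E]

theorem eventuallyEq_zero_dyadicDilates {σ₀ σ : 𝓢(E, ℂ)} (hσ : σ =ᶠ[𝓝 0] 0) {k : ℕ}
    (hk : 0 < k) : dyadicDilates σ₀ σ k =ᶠ[𝓝 0] 0 := by
  have hlim : Filter.Tendsto (fun ξ : E => ((2 : ℝ) ^ k)⁻¹ • ξ) (𝓝 0) (𝓝 0) :=
    (continuous_const_smul _).tendsto' 0 0 (smul_zero _)
  filter_upwards [hlim.eventually hσ] with ξ hξ
  rw [dyadicDilates_apply_of_pos _ _ hk, hξ, Pi.zero_apply, Pi.zero_apply]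

theorem eventuallyEq_zero_sum {ι : Type*} {t : Finset ι} {f : ι → 𝓢(E, ℂ)}
    (hf : ∀ i ∈ t, f i =ᶠ[𝓝 0] 0) : (∑ i ∈ t, f i : 𝓢(E, ℂ)) =ᶠ[𝓝 0] 0 := by
  filter_upwards [(Filter.eventually_all_finset t).2 hf] with ξ hξ
  rw [sum_apply]
  exact Finset.sum_eq_zero hξ

end PieceSymbols

theorem fourierMultiplierCLM_coe_sum {E F ι : Type*} [NormedAddCommGroup E]
    [InnerProductSpace ℝ E] [FiniteDimensional ℝ E] [MeasurableSpace E] [BorelSpace E]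
    [NormedAddCommGroup F] [NormedSpace ℂ F] (t : Finset ι) (f : ι → 𝓢(E, ℂ)) :
    fourierMultiplierCLM F (∑ i ∈ t, f i : 𝓢(E, ℂ)) = ∑ i ∈ t, fourierMultiplierCLM F (f i) := by
  rw [← fourierMultiplierCLM_sum F fun i _ => (f i).hasTemperateGrowth]
  congr 1
  ext ξ
  rw [sum_apply]

namespace CutoffFamily

variable (Φ : CutoffFamily d) (n : ℕ)

/-- The symbol of the block `Δ_0`, with the factor `2 π` of `CutoffFamily.block` included. -/
def lowSymbol : 𝓢(Eu d, ℂ) :=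
  HasCompactSupport.toSchwartzMap (f := fun ξ : Eu d => (Φ.φ n ((2 * Real.pi) • ξ) : ℂ))
    (.intro (isCompact_closedBall 0 (2 ^ (n + 1))) fun ξ hξ => by
      rw [mem_closedBall_zero_iff, not_le] at hξ
      rw [Φ.eq_zero, Complex.ofReal_zero]
      rw [norm_smul, Real.norm_of_nonneg (by positivity)]
      nlinarith [Real.pi_gt_three, norm_nonneg ξ])
    (Complex.ofRealCLM.contDiff.comp ((Φ.smooth n).comp (contDiff_const_smul _)))

/-- The symbol whose dilates by powers of two are the symbols of the blocks `Δ_k`, `k ≥ 1`. -/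
def annulusSymbol : 𝓢(Eu d, ℂ) :=
  Φ.lowSymbol n - dilate 2 two_ne_zero (Φ.lowSymbol n)

/-- The symbols of the blocks `Δ_k`, with the factor `2 π` of `CutoffFamily.block` included. -/
def symbol : ℕ → 𝓢(Eu d, ℂ) := dyadicDilates (Φ.lowSymbol n) (Φ.annulusSymbol n)

/-- The symbols of the pieces `[·]_p` of width `N`. -/
def pieceSymbol (N p : ℕ) : 𝓢(Eu d, ℂ) := ∑ j ∈ Finset.Icc (p - N) (p + N), Φ.symbol n j

theorem lowSymbol_apply (ξ : Eu d) : Φ.lowSymbol n ξ = Φ.φ n ((2 * Real.pi) • ξ) := rfl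

theorem annulusSymbol_apply (ξ : Eu d) :
    Φ.annulusSymbol n ξ = Φ.φ n ((2 * Real.pi) • ξ) - Φ.φ n ((2 * Real.pi) • (2 : ℝ) • ξ) := rfl

theorem symbol_apply (k : ℕ) (ξ : Eu d) :
    Φ.symbol n k ξ = Φ.dyadicSymbol n k ((2 * Real.pi) • ξ) := by
  rcases k with _ | k
  · rfl
  · have htwo : (2 : ℝ) * (2 ^ (k + 1))⁻¹ = (2 ^ k)⁻¹ := by
      rw [pow_succ']
      field_simp
    rw [symbol, dyadicDilates, dilate_apply, annulusSymbol_apply, dyadicSymbol, Complex.ofReal_sub,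
      smul_smul 2, htwo, smul_comm, smul_comm (2 * Real.pi)]

theorem block_eq (k : ℕ) : Φ.block n k = fourierMultiplierCLM ℂ (Φ.symbol n k) := by
  rw [block]
  congr 1
  exact funext fun ξ => (Φ.symbol_apply n k ξ).symm

theorem piece_eq (N p : ℕ) (v : 𝓢'(Eu d, ℂ)) :
    piece Φ n N p v = fourierMultiplierCLM ℂ (Φ.pieceSymbol n N p) v := by
  rw [pieceSymbol, fourierMultiplierCLM_coe_sum, sum_apply, piece]
  simp only [block_eq]

theorem norm_le_of_lowSymbol_ne_zero {ξ : Eu d} (h : Φ.lowSymbol n ξ ≠ 0) :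
    ‖ξ‖ ≤ 2 ^ (n + 1) := by
  contrapose! h
  rw [lowSymbol_apply, Φ.eq_zero, Complex.ofReal_zero]
  rw [norm_smul, Real.norm_of_nonneg (by positivity)]
  nlinarith [Real.pi_gt_three, norm_nonneg ξ]

theorem norm_le_of_annulusSymbol_ne_zero {ξ : Eu d} (h : Φ.annulusSymbol n ξ ≠ 0) :
    ‖ξ‖ ≤ 2 ^ (n + 1) := by
  contrapose! h
  rw [annulusSymbol_apply, Φ.eq_zero, Φ.eq_zero, sub_self]
  all_goals
    simp only [norm_smul, Real.norm_of_nonneg Real.two_pi_pos.le, Real.norm_ofNat]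
    nlinarith [Real.pi_gt_three, norm_nonneg ξ]

theorem annulusSymbol_eq_zero_of_norm_le {ξ : Eu d} (h : ‖ξ‖ ≤ (2 ^ (n + 4))⁻¹) :
    Φ.annulusSymbol n ξ = 0 := by
  have h16 : 16 * ‖ξ‖ ≤ (2 ^ n)⁻¹ := by
    rw [pow_add, mul_inv] at h
    linarith
  rw [annulusSymbol_apply, Φ.eq_one, Φ.eq_one, sub_self]
  all_goals
    simp only [norm_smul, Real.norm_of_nonneg Real.two_pi_pos.le, Real.norm_ofNat]
    nlinarith [Real.pi_lt_four, norm_nonneg ξ]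

theorem annulusSymbol_eventuallyEq_zero : Φ.annulusSymbol n =ᶠ[𝓝 0] 0 := by
  filter_upwards [Metric.closedBall_mem_nhds (0 : Eu d)
    (inv_pos.2 (pow_pos two_pos (n + 4)))] with ξ hξ
  exact Φ.annulusSymbol_eq_zero_of_norm_le n (mem_closedBall_zero_iff.1 hξ)

theorem exists_isDyadic_symbol : ∃ B, IsDyadic (n + 5) B (fun k => Φ.symbol n k) := by
  have hpow : (2 : ℝ) ^ (n + 1) ≤ 2 ^ (n + 4) := by gcongr <;> norm_num
  refine ⟨_, isDyadic_dyadicDilates (r := n + 4)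
    (fun ξ h => (Φ.norm_le_of_lowSymbol_ne_zero n h).trans hpow)
    fun ξ h => ⟨?_, (Φ.norm_le_of_annulusSymbol_ne_zero n h).trans hpow⟩⟩
  contrapose! h
  exact Φ.annulusSymbol_eq_zero_of_norm_le n h.le

theorem exists_isDyadic_pieceSymbol (N : ℕ) :
    ∃ B, IsDyadic (n + 5 + N) B (fun p => Φ.pieceSymbol n N p) := by
  obtain ⟨B, hB⟩ := Φ.exists_isDyadic_symbol n
  refine ⟨_, (hB.sum_Icc N).congr fun p ξ => ?_⟩
  rw [pieceSymbol, sum_apply]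

theorem exists_isLpBounded_top_symbol :
    ∃ C, 0 ≤ C ∧ ∀ k, IsLpBounded ⊤ C (fourierMultiplierCLM ℂ (Φ.symbol n k)) :=
  exists_isLpBounded_top_dyadicDilates _ _

theorem exists_isLpBounded_top_pieceSymbol (N : ℕ) :
    ∃ C, 0 ≤ C ∧ ∀ p, IsLpBounded ⊤ C (fourierMultiplierCLM ℂ (Φ.pieceSymbol n N p)) := by
  obtain ⟨C, hC, hbound⟩ := Φ.exists_isLpBounded_top_symbol n
  refine ⟨(2 * N + 1) * C, by positivity, fun p => ?_⟩
  rw [pieceSymbol, fourierMultiplierCLM_coe_sum]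
  refine (IsLpBounded.sum fun j _ => hbound j).mono ((Real.le_norm_self _).trans ?_)
  exact norm_sum_Icc_sub_add_le hC fun _ _ => (Real.norm_of_nonneg hC).le

theorem summable_piece (N : ℕ) {A s : ℝ} {V : ℕ → Lp ℂ ⊤ (volume : Measure (Eu d))}
    (hV : ∀ p : ℕ, ‖V p‖ ≤ A * 2 ^ (-(p * s))) :
    Summable fun p => piece Φ n N p (V p : 𝓢'(Eu d, ℂ)) := by
  rw [← summable_nat_add_iff (N + 1)]
  have hsupp : HasCompactSupport (Φ.pieceSymbol n N (N + 1)) :=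
    let ⟨_, hB⟩ := Φ.exists_isDyadic_pieceSymbol n N
    hB.hasCompactSupport (N + 1)
  have hzero : Φ.pieceSymbol n N (N + 1) =ᶠ[𝓝 0] 0 :=
    eventuallyEq_zero_sum fun j hj => eventuallyEq_zero_dyadicDilates
      (Φ.annulusSymbol_eventuallyEq_zero n) (by rw [Finset.mem_Icc] at hj; omega)
  have hshift (p : ℕ) : ‖V (p + (N + 1))‖ ≤ A * 2 ^ (-((N + 1) * s)) * 2 ^ (-(p * s)) := by
    refine (hV _).trans_eq ?_
    rw [mul_assoc, ← Real.rpow_add two_pos]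
    push_cast
    ring_nf
  refine (summable_fourierMultiplierCLM_dilate hsupp hzero hshift).congr fun p => ?_
  rw [piece_eq, pieceSymbol, pieceSymbol, symbol, sum_Icc_dyadicDilates_add]

end CutoffFamily

section Zygmund

variable {Φ : CutoffFamily d} {n : ℕ} {s : ℝ} {u : 𝓢'(Eu d, ℂ)}

theorem exists_block_eq_coe_of_zygmundNorm_lt_top (hu : zygmundNorm Φ n s u < ⊤) (q : ℕ) :
    ∃ f : Lp ℂ ⊤ (volume : Measure (Eu d)),
      Φ.block n q u = f ∧ ‖f‖ ≤ (zygmundNorm Φ n s u).toReal * 2 ^ (-(q * s)) := by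
  have hpos : (0 : ℝ) < 2 ^ (q * s) := by positivity
  have hle : ENNReal.ofReal (2 ^ (q * s)) * distLpNorm ⊤ (Φ.block n q u) ≤ zygmundNorm Φ n s u :=
    le_iSup (fun q : ℕ => ENNReal.ofReal (2 ^ (q * s)) * distLpNorm ⊤ (Φ.block n q u)) q
  have hlt : distLpNorm ⊤ (Φ.block n q u) < ⊤ :=
    ENNReal.lt_top_of_mul_ne_top_right (hle.trans_lt hu).ne (by simpa using hpos)
  obtain ⟨f, hf⟩ := exists_eq_coe_of_distLpNorm_lt_top hlt
  refine ⟨f, hf, ?_⟩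
  rw [hf, distLpNorm_coe, ← ofReal_norm, ← ENNReal.ofReal_mul hpos.le,
    ENNReal.ofReal_le_iff_le_toReal hu.ne] at hle
  rwa [Real.rpow_neg two_pos.le, ← div_eq_mul_inv, le_div_iff₀' hpos]

theorem zygmundNorm_le {A : ℝ} (h : ∀ q, ∃ f : Lp ℂ ⊤ (volume : Measure (Eu d)),
    Φ.block n q u = f ∧ ‖f‖ ≤ A * 2 ^ (-(q * s))) : zygmundNorm Φ n s u ≤ ENNReal.ofReal A := by
  refine iSup_le fun q => ?_
  obtain ⟨f, hf, hfA⟩ := h q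
  have hpos : (0 : ℝ) < 2 ^ (q * s) := by positivity
  rw [hf, distLpNorm_coe, ← ofReal_norm, ← ENNReal.ofReal_mul hpos.le]
  refine ENNReal.ofReal_le_ofReal ?_
  rwa [Real.rpow_neg two_pos.le, ← div_eq_mul_inv, le_div_iff₀' hpos] at hfA

theorem exists_isGlobalParacomposition_zygmundNorm_le (Φ : CutoffFamily d) (n N : ℕ) (s : ℝ) :
    ∃ K : ℝ≥0, ∀ (κ : Eu d → Eu d) (C : ℝ≥0), Measurable κ →
      (volume : Measure (Eu d)).map κ ≤ (C : ℝ≥0∞) • volume →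
      ∀ u : 𝓢'(Eu d, ℂ), zygmundNorm Φ 0 s u < ⊤ → ∃ w : 𝓢'(Eu d, ℂ),
        IsGlobalParacomposition Φ n N κ u w ∧
        zygmundNorm Φ n s w ≤ K * zygmundNorm Φ 0 s u := by
  obtain ⟨B, hB⟩ := Φ.exists_isDyadic_symbol n
  obtain ⟨B', hB'⟩ := Φ.exists_isDyadic_pieceSymbol n N
  obtain ⟨C₁, hC₁, hsymbol⟩ := Φ.exists_isLpBounded_top_symbol n
  obtain ⟨C₂, hC₂, hpiece⟩ := Φ.exists_isLpBounded_top_pieceSymbol n N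
  set K : ℝ := (2 * ↑(n + 5 + N + (n + 5)) + 1) *
    (C₁ * C₂ * 2 ^ (↑(n + 5 + N + (n + 5)) * |s|))
  have hK : 0 ≤ K := by positivity
  refine ⟨K.toNNReal, fun κ C hκ hmap u hu => ?_⟩
  choose f hf hfu using exists_block_eq_coe_of_zygmundNorm_lt_top hu
  choose V hVf hV using fun p => exists_isComposition_coe hκ hmap (f p)
  have hVu (p : ℕ) : ‖V p‖ ≤ (zygmundNorm Φ 0 s u).toReal * 2 ^ (-(p * s)) :=
    (by simpa using hV p : ‖V p‖ ≤ ‖f p‖).trans (hfu p)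
  obtain ⟨w, hw⟩ := Φ.summable_piece n N hVu
  refine ⟨w, ⟨fun p => V p, fun p => hf p ▸ hVf p, hw⟩, ?_⟩
  simp only [CutoffFamily.piece_eq] at hw
  have hblock (q : ℕ) :=
    hB.exists_norm_fourierMultiplierCLM_le hB' hC₁ hC₂ hsymbol hpiece hVu hw q
  simp only [← CutoffFamily.block_eq] at hblock
  refine (zygmundNorm_le hblock).trans_eq ?_
  rw [ENNReal.ofReal_mul hK, ENNReal.ofReal_toReal hu.ne, ENNReal.ofReal]

end Zygmund

section Plancherel

variable {α F : Type*} [MeasurableSpace α] {μ : Measure α} [NormedAddCommGroup F]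

theorem integrable_norm_sq (f : Lp F 2 μ) : Integrable (fun x => ‖f x‖ ^ 2) μ :=
  (memLp_two_iff_integrable_sq_norm (Lp.memLp f).1).1 (Lp.memLp f)

theorem norm_sq_eq_integral (f : Lp F 2 μ) : ‖f‖ ^ 2 = ∫ x, ‖f x‖ ^ 2 ∂μ := by
  have hnonneg : 0 ≤ ∫ x, ‖f x‖ ^ 2 ∂μ := by positivity
  rw [Lp.norm_def, (Lp.memLp f).eLpNorm_eq_integral_rpow_norm two_ne_zero ENNReal.ofNat_ne_top]
  simp only [ENNReal.toReal_ofNat, Real.rpow_ofNat]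
  rw [ENNReal.toReal_ofReal (by positivity), ← Real.rpow_mul_natCast hnonneg]
  norm_num

variable {E : Type*} [NormedAddCommGroup E] [InnerProductSpace ℝ E] [FiniteDimensional ℝ E]
  [MeasurableSpace E] [BorelSpace E] [InnerProductSpace ℂ F] [CompleteSpace F]

theorem norm_sq_eq_integral_fourier (f : Lp F 2 (volume : Measure E)) :
    ‖f‖ ^ 2 = ∫ ξ, ‖𝓕 f ξ‖ ^ 2 := by
  rw [← norm_sq_eq_integral, Lp.norm_fourier_eq]

theorem exists_fourierMultiplierCLM_eq_coe {g : E → ℂ} (hg : g.HasTemperateGrowth) {B : ℝ}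
    (hB : ∀ ξ, ‖g ξ‖ ≤ B) (f : Lp F 2 (volume : Measure E)) :
    ∃ h : Lp F 2 (volume : Measure E),
      fourierMultiplierCLM F g f = (h : 𝓢'(E, F)) ∧ ∀ᵐ ξ, 𝓕 h ξ = g ξ • 𝓕 f ξ := by
  have hm : MemLp g ⊤ (volume : Measure E) :=
    memLp_top_of_bound hg.1.continuous.aestronglyMeasurable B (.of_forall hB)
  refine ⟨𝓕⁻ (hm.toLp g • 𝓕 f : Lp F 2 (volume : Measure E)), ?_, ?_⟩
  · rw [fourierMultiplierCLM_apply, Lp.fourier_toTemperedDistribution_eq,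
      ← Lp.fourierInv_toTemperedDistribution_eq, Lp.toTemperedDistribution_smul_eq hg]
  · rw [FourierTransform.fourier_fourierInv_eq]
    filter_upwards [Lp.coeFn_lpSMul (r := 2) (hm.toLp g) (𝓕 f), hm.coeFn_toLp] with ξ hsmul hcoe
    rw [hsmul, Pi.smul_apply', hcoe]

end Plancherel

section Bessel

variable {E F : Type*} [NormedAddCommGroup E] [InnerProductSpace ℝ E] [FiniteDimensional ℝ E]
  [MeasurableSpace E] [BorelSpace E] [NormedAddCommGroup F] [NormedSpace ℂ F]

theorem fourierMultiplierCLM_weighted {g : E → ℂ} (hg : g.HasTemperateGrowth) (c s : ℝ)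
    (v : 𝓢'(E, F)) :
    fourierMultiplierCLM F (fun ξ => (c : ℂ) * ((((1 + ‖ξ‖ ^ 2) ^ (s / 2) : ℝ) : ℂ) * g ξ)) v =
      (c : ℂ) • besselPotential E F s (fourierMultiplierCLM F g v) := by
  have hb : (fun ξ : E => (((1 + ‖ξ‖ ^ 2) ^ (s / 2) : ℝ) : ℂ)).HasTemperateGrowth := by fun_prop
  rw [besselPotential, fourierMultiplierCLM_fourierMultiplierCLM_apply hg hb, ← smul_apply,
    ← fourierMultiplierCLM_smul (hg.mul hb)]
  congr 2
  ext ξ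
  simp only [Pi.smul_apply, Pi.mul_apply, smul_eq_mul, mul_comm (g ξ)]

theorem besselPotential_fourierMultiplierCLM {g : E → ℂ} (hg : g.HasTemperateGrowth) (s : ℝ)
    (v : 𝓢'(E, F)) :
    besselPotential E F s (fourierMultiplierCLM F g v) =
      fourierMultiplierCLM F g (besselPotential E F s v) := by
  have hb : (fun ξ : E => (((1 + ‖ξ‖ ^ 2) ^ (s / 2) : ℝ) : ℂ)).HasTemperateGrowth := by fun_prop
  rw [besselPotential, fourierMultiplierCLM_fourierMultiplierCLM_apply hg hb,
    fourierMultiplierCLM_fourierMultiplierCLM_apply hb hg, mul_comm]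

end Bessel

theorem two_rpow_neg_mul_two_rpow (t : ℝ) : (2 : ℝ) ^ (-t) * 2 ^ t = 1 := by
  rw [← Real.rpow_add two_pos, neg_add_cancel, Real.rpow_zero]

theorem exists_hasSum_norm_sq_le {ι V : Type*} [SeminormedAddCommGroup V] [CompleteSpace V]
    {g : ι → V} {x : ι → ℝ} {K A : ℝ} (hK : 0 ≤ K) (hx : ∀ p, 0 ≤ x p)
    (hg : ∀ P : Finset ι, ‖∑ p ∈ P, g p‖ ^ 2 ≤ K * ∑ p ∈ P, x p)
    (hA : ∀ P : Finset ι, ∑ p ∈ P, x p ≤ A) : ∃ w, HasSum g w ∧ ‖w‖ ^ 2 ≤ K * A := by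
  have hKx : Summable fun p => K * x p := (summable_of_sum_le hx hA).mul_left K
  have hsum : Summable g := by
    refine summable_iff_vanishing_norm.2 fun ε hε => ?_
    obtain ⟨S, hS⟩ := summable_iff_vanishing_norm.1 hKx (ε ^ 2) (by positivity)
    refine ⟨S, fun P hP => lt_of_pow_lt_pow_left₀ 2 hε.le ((hg P).trans_lt ?_)⟩
    rw [Finset.mul_sum]
    exact (le_abs_self _).trans_lt (hS P hP)
  refine ⟨_, hsum.hasSum, le_of_tendsto (hsum.hasSum.norm.pow 2) (.of_forall fun P => ?_)⟩
  exact (hg P).trans (by gcongr; exact hA P)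

section SquareFunctions

variable {E F : Type*} [NormedAddCommGroup E] [InnerProductSpace ℝ E] [FiniteDimensional ℝ E]
  [MeasurableSpace E] [BorelSpace E] [NormedAddCommGroup F] [InnerProductSpace ℂ F]
  [CompleteSpace F] {R : ℕ} {B : ℝ} {a : ℕ → E → ℂ}

namespace IsDyadic

theorem fourier_ae_eq (ha : IsDyadic R B a) {p : ℕ} {f g : Lp F 2 (volume : Measure E)}
    (h : fourierMultiplierCLM F (a p) f = (g : 𝓢'(E, F))) : ∀ᵐ ξ, 𝓕 g ξ = a p ξ • 𝓕 f ξ := by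
  obtain ⟨g', h', hg'⟩ :=
    exists_fourierMultiplierCLM_eq_coe (ha.hasTemperateGrowth p) (ha.norm_le p) f
  rwa [← toTemperedDistribution_injective (h'.symm.trans h)]

theorem sum_norm_fourierMultiplierCLM_sq_le (ha : IsDyadic R B a)
    {f : Lp F 2 (volume : Measure E)} {g : ℕ → Lp F 2 (volume : Measure E)}
    (h : ∀ p, fourierMultiplierCLM F (a p) f = (g p : 𝓢'(E, F))) (P : Finset ℕ) :
    ∑ p ∈ P, ‖g p‖ ^ 2 ≤ (2 * ↑(R + R) + 1) * B ^ 2 * ‖f‖ ^ 2 := by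
  simp only [norm_sq_eq_integral_fourier]
  rw [← integral_finsetSum _ fun p _ => integrable_norm_sq _, ← integral_const_mul]
  refine integral_mono_ae (integrable_finsetSum _ fun p _ => integrable_norm_sq _)
    ((integrable_norm_sq _).const_mul _) ?_
  filter_upwards [ae_all_iff.2 fun p => ha.fourier_ae_eq (h p)] with ξ hξ
  simp only [hξ, norm_smul, mul_pow]
  rw [← Finset.sum_mul]
  gcongr
  exact ha.sum_norm_sq_le P ξ

theorem norm_sum_fourierMultiplierCLM_sq_le (ha : IsDyadic R B a)
    {f g : ℕ → Lp F 2 (volume : Measure E)}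
    (h : ∀ p, fourierMultiplierCLM F (a p) (f p) = (g p : 𝓢'(E, F))) (P : Finset ℕ) :
    ‖∑ p ∈ P, g p‖ ^ 2 ≤ (2 * ↑(R + R) + 1) * B ^ 2 * ∑ p ∈ P, ‖f p‖ ^ 2 := by
  simp only [norm_sq_eq_integral_fourier]
  rw [← integral_finsetSum _ fun p _ => integrable_norm_sq _, ← integral_const_mul]
  refine integral_mono_ae (integrable_norm_sq _)
    ((integrable_finsetSum _ fun p _ => integrable_norm_sq _).const_mul _) ?_
  have hsum : 𝓕 (∑ p ∈ P, g p) = ∑ p ∈ P, 𝓕 (g p) := map_sum (Lp.fourierTransformₗᵢ E F) g P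
  filter_upwards [ae_all_iff.2 fun p => ha.fourier_ae_eq (h p),
    Lp.coeFn_finsetSum P fun p => 𝓕 (g p)] with ξ hξ hcoe
  rw [hsum, hcoe, Finset.sum_apply]
  simp only [hξ]
  calc ‖∑ p ∈ P, a p ξ • 𝓕 (f p) ξ‖ ^ 2 ≤ (∑ p ∈ P, ‖a p ξ‖ * ‖𝓕 (f p) ξ‖) ^ 2 := by
        gcongr
        exact norm_sum_le_of_le _ fun p _ => (norm_smul _ _).le
    _ ≤ (∑ p ∈ P, ‖a p ξ‖ ^ 2) * ∑ p ∈ P, ‖𝓕 (f p) ξ‖ ^ 2 := Finset.sum_mul_sq_le_sq_mul_sq _ _ _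
    _ ≤ _ := by
      gcongr
      exact ha.sum_norm_sq_le P ξ

theorem exists_sum_sq_le_of_besselPotential_eq (ha : IsDyadic R B a) {s : ℝ} {u : 𝓢'(E, F)}
    {U : Lp F 2 (volume : Measure E)} (hU : besselPotential E F s u = (U : 𝓢'(E, F))) :
    ∃ f : ℕ → Lp F 2 (volume : Measure E),
      (∀ p, fourierMultiplierCLM F (a p) u = (f p : 𝓢'(E, F))) ∧
      ∀ P : Finset ℕ, ∑ p ∈ P, ((2 : ℝ) ^ (p * s) * ‖f p‖) ^ 2 ≤
        (2 * ↑(R + R) + 1) * (2 ^ (R * |s|) * B) ^ 2 * ‖U‖ ^ 2 := by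
  have hw := ha.weighted s
  choose g hg _ using fun p =>
    exists_fourierMultiplierCLM_eq_coe (hw.hasTemperateGrowth p) (hw.norm_le p) U
  refine ⟨fun p => (((2 : ℝ) ^ (-(p * s)) : ℝ) : ℂ) • g p, fun p => ?_, fun P => ?_⟩
  · rw [← Lp.toTemperedDistributionCLM_apply, map_smul, Lp.toTemperedDistributionCLM_apply, ← hg,
      fourierMultiplierCLM_weighted (ha.hasTemperateGrowth p), ← hU,
      besselPotential_fourierMultiplierCLM (ha.hasTemperateGrowth p),
      besselPotential_besselPotential_apply, add_neg_cancel, besselPotential_zero,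
      ContinuousLinearMap.id_apply, smul_smul, ← Complex.ofReal_mul, two_rpow_neg_mul_two_rpow,
      Complex.ofReal_one, one_smul]
  · refine le_of_eq_of_le (Finset.sum_congr rfl fun p _ => ?_)
      (hw.sum_norm_fourierMultiplierCLM_sq_le hg P)
    rw [norm_smul, Complex.norm_real, Real.norm_of_nonneg (by positivity), ← mul_assoc,
      mul_comm ((2 : ℝ) ^ (p * s)), two_rpow_neg_mul_two_rpow, one_mul]

theorem exists_hasSum_besselPotential_eq (hb : IsDyadic R B a) {s A : ℝ}
    {V : ℕ → Lp F 2 (volume : Measure E)}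
    (hV : ∀ P : Finset ℕ, ∑ p ∈ P, ((2 : ℝ) ^ (p * s) * ‖V p‖) ^ 2 ≤ A) :
    ∃ (w : 𝓢'(E, F)) (W : Lp F 2 (volume : Measure E)),
      HasSum (fun p => fourierMultiplierCLM F (a p) (V p : 𝓢'(E, F))) w ∧
      besselPotential E F s w = (W : 𝓢'(E, F)) ∧
      ‖W‖ ^ 2 ≤ (2 * ↑(R + R) + 1) * (2 ^ (R * |(-s)|) * B) ^ 2 * A := by
  have hw := hb.weighted (-s)
  set x : ℕ → Lp F 2 (volume : Measure E) := fun p => (((2 : ℝ) ^ (p * s) : ℝ) : ℂ) • V p with hx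
  have hnorm (p : ℕ) : ‖x p‖ = 2 ^ (p * s) * ‖V p‖ := by
    rw [norm_smul, Complex.norm_real, Real.norm_of_nonneg (by positivity)]
  choose g hg _ using fun p =>
    exists_fourierMultiplierCLM_eq_coe (hw.hasTemperateGrowth p) (hw.norm_le p) (x p)
  obtain ⟨W, hW, hWA⟩ := exists_hasSum_norm_sq_le (by positivity) (fun p => sq_nonneg ‖x p‖)
    (hw.norm_sum_fourierMultiplierCLM_sq_le hg) (by simpa only [hnorm] using hV)
  have hgV (p : ℕ) : besselPotential E F (-s) (g p : 𝓢'(E, F)) =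
      fourierMultiplierCLM F (a p) (V p : 𝓢'(E, F)) := by
    rw [← hg, fourierMultiplierCLM_weighted (hb.hasTemperateGrowth p), neg_neg, map_smul,
      besselPotential_besselPotential_apply, add_neg_cancel, besselPotential_zero,
      ContinuousLinearMap.id_apply, hx, ← Lp.toTemperedDistributionCLM_apply, map_smul, map_smul,
      smul_smul, ← Complex.ofReal_mul, mul_neg, two_rpow_neg_mul_two_rpow, Complex.ofReal_one,
      one_smul, Lp.toTemperedDistributionCLM_apply]
  refine ⟨besselPotential E F (-s) W, W, ?_, by simp, hWA⟩
  refine (hW.mapL (besselPotential E F (-s) ∘L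
    Lp.toTemperedDistributionCLM F (volume : Measure E) 2)).congr_fun fun p => ?_
  exact (hgV p).symm

end IsDyadic

end SquareFunctions

section Sobolev

theorem sobolevNorm_of_besselPotential_eq {s : ℝ} {u : 𝓢'(Eu d, ℂ)}
    {U : Lp ℂ 2 (volume : Measure (Eu d))}
    (h : besselPotential (Eu d) ℂ s u = (U : 𝓢'(Eu d, ℂ))) : sobolevNorm s u = ‖U‖ₑ := by
  rw [sobolevNorm, h, distLpNorm_coe]

theorem exists_isGlobalParacomposition_sobolevNorm_le (Φ : CutoffFamily d) (n N : ℕ) (s : ℝ)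
    (C : ℝ≥0) :
    ∃ K : ℝ≥0, ∀ κ : Eu d → Eu d, Measurable κ →
      (volume : Measure (Eu d)).map κ ≤ (C : ℝ≥0∞) • volume →
      ∀ u : 𝓢'(Eu d, ℂ), MemSobolev s 2 u → ∃ w : 𝓢'(Eu d, ℂ),
        IsGlobalParacomposition Φ n N κ u w ∧ MemSobolev s 2 w ∧
        sobolevNorm s w ≤ K * sobolevNorm s u := by
  obtain ⟨B, hB⟩ := Φ.exists_isDyadic_symbol 0
  obtain ⟨B', hB'⟩ := Φ.exists_isDyadic_pieceSymbol n N
  set Ka : ℝ := (2 * (0 + 5 + (0 + 5) : ℕ) + 1) * (2 ^ ((0 + 5 : ℕ) * |s|) * B) ^ 2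
  set Kb : ℝ := (2 * (n + 5 + N + (n + 5 + N) : ℕ) + 1) *
    (2 ^ ((n + 5 + N : ℕ) * |(-s)|) * B') ^ 2
  set A : ℝ := (C : ℝ) ^ (1 / 2 : ℝ≥0∞).toReal
  have hK : 0 ≤ Kb * (A ^ 2 * Ka) := by positivity
  refine ⟨(√(Kb * (A ^ 2 * Ka))).toNNReal, fun κ hκ hmap u ⟨U, hU⟩ => ?_⟩
  obtain ⟨f, hf, hfU⟩ := hB.exists_sum_sq_le_of_besselPotential_eq hU
  choose V hVf hV using fun p => exists_isComposition_coe hκ hmap (f p)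
  have hVU (P : Finset ℕ) : ∑ p ∈ P, ((2 : ℝ) ^ (p * s) * ‖V p‖) ^ 2 ≤ A ^ 2 * (Ka * ‖U‖ ^ 2) := by
    calc ∑ p ∈ P, ((2 : ℝ) ^ (p * s) * ‖V p‖) ^ 2
        ≤ ∑ p ∈ P, (2 ^ (p * s) * (A * ‖f p‖)) ^ 2 := by gcongr with p; exact hV p
      _ = A ^ 2 * ∑ p ∈ P, (2 ^ (p * s) * ‖f p‖) ^ 2 := by
        rw [Finset.mul_sum]
        exact Finset.sum_congr rfl fun p _ => by ring
      _ ≤ A ^ 2 * (Ka * ‖U‖ ^ 2) := by gcongr; exact hfU P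
  obtain ⟨w, W, hw, hW, hWU⟩ := hB'.exists_hasSum_besselPotential_eq hVU
  refine ⟨w, ⟨fun p => V p, fun p => ?_, ?_⟩, ⟨W, hW⟩, ?_⟩
  · rw [CutoffFamily.block_eq, hf]
    exact hVf p
  · simpa only [CutoffFamily.piece_eq] using hw
  · rw [sobolevNorm_of_besselPotential_eq hW, sobolevNorm_of_besselPotential_eq hU, ← ofReal_norm,
      ← ofReal_norm, ← ENNReal.ofReal, ← ENNReal.ofReal_mul (Real.sqrt_nonneg _)]
    refine ENNReal.ofReal_le_ofReal (le_of_sq_le_sq ?_ (by positivity))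
    rw [mul_pow, Real.sq_sqrt hK]
    exact hWU.trans_eq (by ring)

end Sobolev

end Paracomp

end

theorem mainTheorem6_general (d : ℕ) (Φ : Paracomp.CutoffFamily d) (n N : ℕ) (s : ℝ) (C : ℝ≥0) :
    ∃ K : ℝ≥0, ∀ κ : Paracomp.Eu d → Paracomp.Eu d, Measurable κ →
      (volume : Measure (Paracomp.Eu d)).map κ ≤ (C : ℝ≥0∞) • volume →
      (∀ u : 𝓢'(Paracomp.Eu d, ℂ), Paracomp.zygmundNorm Φ 0 s u < ⊤ →
        ∃ w : 𝓢'(Paracomp.Eu d, ℂ),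
          Paracomp.IsGlobalParacomposition Φ n N κ u w ∧
          (∀ w', Paracomp.IsGlobalParacomposition Φ n N κ u w' → w' = w) ∧
          Paracomp.zygmundNorm Φ n s w ≤ K * Paracomp.zygmundNorm Φ 0 s u) ∧
      (∀ u : 𝓢'(Paracomp.Eu d, ℂ), MemSobolev s 2 u →
        ∃ w : 𝓢'(Paracomp.Eu d, ℂ),
          Paracomp.IsGlobalParacomposition Φ n N κ u w ∧
          (∀ w', Paracomp.IsGlobalParacomposition Φ n N κ u w' → w' = w) ∧
          MemSobolev s 2 w ∧
          Paracomp.sobolevNorm s w ≤ K * Paracomp.sobolevNorm s u) := by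
  obtain ⟨K₁, hK₁⟩ := Paracomp.exists_isGlobalParacomposition_zygmundNorm_le Φ n N s
  obtain ⟨K₂, hK₂⟩ := Paracomp.exists_isGlobalParacomposition_sobolevNorm_le Φ n N s C
  refine ⟨K₁ + K₂, fun κ hκ hmap => ?_⟩
  have hquasi : Measure.QuasiMeasurePreserving κ volume volume :=
    ⟨hκ, Measure.absolutelyContinuous_of_le_smul hmap⟩
  refine ⟨fun u hu => ?_, fun u hu => ?_⟩
  · obtain ⟨w, hw, hle⟩ := hK₁ κ C hκ hmap u hu
    refine ⟨w, hw, fun w' hw' => hw.unique hquasi hw', hle.trans ?_⟩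
    gcongr
    exact le_self_add
  · obtain ⟨w, hw, hmem, hle⟩ := hK₂ κ hκ hmap u hu
    refine ⟨w, hw, fun w' hw' => hw.unique hquasi hw', hmem, hle.trans ?_⟩
    gcongr
    exact le_add_self

theorem mainTheorem6 (d : ℕ) (Φ : Paracomp.CutoffFamily d) (n₀ N : ℝ → ℝ → ℕ) (s : ℝ) :
    ∃ F : ℝ → ℝ → ℝ≥0, ∀ (κ : Paracomp.Eu d ≃ Paracomp.Eu d) (m₀ L : ℝ),
      ContDiff ℝ 1 κ → ContDiff ℝ 1 κ.symm →
      IsLUB (Set.range fun x => ‖fderiv ℝ κ x‖) L →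
      0 < m₀ → (∀ x, m₀ ≤ |(fderiv ℝ κ x).det|) →
      (∀ u : 𝓢'(Paracomp.Eu d, ℂ), Paracomp.zygmundNorm Φ 0 s u < ⊤ →
        ∃ w : 𝓢'(Paracomp.Eu d, ℂ),
          Paracomp.IsGlobalParacomposition Φ (n₀ m₀ L) (N m₀ L) κ u w ∧
          (∀ w', Paracomp.IsGlobalParacomposition Φ (n₀ m₀ L) (N m₀ L) κ u w' → w' = w) ∧
          Paracomp.zygmundNorm Φ (n₀ m₀ L) s w ≤ F m₀ L * Paracomp.zygmundNorm Φ 0 s u) ∧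
      (∀ u : 𝓢'(Paracomp.Eu d, ℂ), MemSobolev s 2 u →
        ∃ w : 𝓢'(Paracomp.Eu d, ℂ),
          Paracomp.IsGlobalParacomposition Φ (n₀ m₀ L) (N m₀ L) κ u w ∧
          (∀ w', Paracomp.IsGlobalParacomposition Φ (n₀ m₀ L) (N m₀ L) κ u w' → w' = w) ∧
          MemSobolev s 2 w ∧
          Paracomp.sobolevNorm s w ≤ F m₀ L * Paracomp.sobolevNorm s u) := by
  choose F hF using fun m L =>
    mainTheorem6_general d Φ (n₀ m L) (N m L) s (m.toNNReal⁻¹)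
  refine ⟨F, fun κ m₀ L hκ _ _ hm hdet => hF m₀ L κ hκ.continuous.measurable ?_⟩
  refine Paracomp.map_le_smul_of_le_abs_det volume
    (fun x => (hκ.differentiable one_ne_zero x).hasFDerivAt) κ.injective
    (Real.toNNReal_pos.2 hm).ne' fun x => ?_
  rw [Real.coe_toNNReal m₀ hm.le]
  exact hdet x
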